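/- Let $S \subset {]0,+\infty[}$. An \emph{ordered ultrametric space} is a metric space $(X,d)$ satisfying $d(x,z)\le\max(d(x,y),d(y,z))$ for all $x,y,z\in X$, together with a linear ordering $<$ of $X$; the ordering is \emph{convex} if every metric ball of $X$ is $<$-convex. Let $\mathcal{U}^{c<}_S$ be the class of all finite ordered ultrametric spaces whose ordering is convex and in which the distance between any two distinct points belongs to $S$. Two ordered ultrametric spaces are isomorphic if there is an order preserving isometry from one onto the other, and $\binom{Z}{X}$ denotes the set of all subspaces of $Z$ (with the induced metric and ordering) that are isomorphic to $X$. Then $\mathcal{U}^{c<}_S$ has the Ramsey property: for all $X, Y \in \mathcal{U}^{c<}_S$ and every integer $k \ge 1$ there is $Z \in \mathcal{U}^{c<}_S$ such that $Z \longrightarrow (Y)^{X}_{k}$, that is, for every map $\chi : \binom{Z}{X} \to \{0,\dots,k-1\}$ there is $\widetilde{Y} \in \binom{Z}{Y}$ such that $\chi$ takes at most one value on $\binom{\widetilde{Y}}{X}$. -/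

import Mathlib

universe u

/-- An ordered ultrametric space: an ultrametric space together with a linear ordering of its
underlying set.  No compatibility between the metric and the ordering is required here. -/
structure OrdUltrametricSpace : Type (u + 1) where
  carrier : Type u
  [metricSpace : MetricSpace carrier]
  [isUltrametricDist : IsUltrametricDist carrier]
  [linearOrder : LinearOrder carrier]

namespace OrdUltrametricSpace

attribute [instance] OrdUltrametricSpace.metricSpace OrdUltrametricSpace.isUltrametricDist
  OrdUltrametricSpace.linearOrder

/-- The ordering is convex: all metric balls, open and closed, are order-convex. -/
def ConvexlyOrdered (X : OrdUltrametricSpace.{u}) : Prop :=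
  ∀ (x : X.carrier) (r : ℝ),
    (Metric.ball x r).OrdConnected ∧ (Metric.closedBall x r).OrdConnected

/-- The distance between any two distinct points lies in `S`. -/
def DistancesIn (X : OrdUltrametricSpace.{u}) (S : Set ℝ) : Prop :=
  ∀ x y : X.carrier, x ≠ y → dist x y ∈ S

/-- The class of finite convexly ordered ultrametric spaces with distances in `S`. -/
def finiteConvexlyOrdered (S : Set ℝ) : Set OrdUltrametricSpace.{u} :=
  {X | Finite X.carrier ∧ X.ConvexlyOrdered ∧ X.DistancesIn S}

/-- The set of all subspaces of `Z` (with the induced metric and ordering) which are isomorphic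
to `X`, that is, which are the image of `X` under an order preserving surjective isometry. -/
def copies (Z X : OrdUltrametricSpace.{u}) : Set (Set Z.carrier) :=
  {A | ∃ e : X.carrier ≃o A, Isometry e}

/-- The arrow relation `Z ⟶ (Y)^X_k`: for every colouring of the copies of `X` in `Z` with `k`
colours there is a copy `B` of `Y` in `Z` such that all the copies of `X` contained in `B`
have the same colour. -/
def Arrows (Z Y X : OrdUltrametricSpace.{u}) (k : ℕ) : Prop :=
  ∀ χ : Z.copies X → Fin k, ∃ B ∈ Z.copies Y,
    ∀ A A' : Z.copies X, A.1 ⊆ B → A'.1 ⊆ B → χ A = χ A'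

/-- The Ramsey property of a class `K` of ordered ultrametric spaces. -/
def RamseyProperty (K : Set OrdUltrametricSpace.{u}) : Prop :=
  ∀ X ∈ K, ∀ Y ∈ K, ∀ k : ℕ, 0 < k → ∃ Z ∈ K, Z.Arrows Y X k

end OrdUltrametricSpace

/-! Let `D ⊆ S` be a finite set containing all distances of `X` and `Y`. By convexity, the open
balls with radii in `D`, tagged by radius, form a finite linear order `Class X hX D`. Sending a
point to the list of labels of its balls turns an order embedding of this order into `β` into an
order preserving isometric embedding of `X` into the lexicographic space `D → β` (`realize`). An
embedding of `X` into `Y` induces one of `Class X` into `Class Y` (`mapClass`), compatibly with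
`realize`. The theorem thus reduces to Ramsey's theorem for finite linear orders: only copies of `X`
inside a realized copy of `Y` must be controlled, and they all arise from labellings. -/

/-- The finite Ramsey theorem for finite sets of natural numbers. -/
theorem Finset.exists_card_eq_forall_card_eq_coloring (n m k : ℕ) :
    ∃ N : ℕ, ∀ (V : Finset ℕ) (χ : Finset ℕ → Fin k), N ≤ V.card →
      ∃ B ⊆ V, B.card = m ∧
        ∀ A ⊆ B, ∀ A' ⊆ B, A.card = n → A'.card = n → χ A = χ A' := by
  induction n generalizing m with
  | zero =>
    refine ⟨m, fun V χ hV => ?_⟩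
    obtain ⟨B, hBV, hB⟩ := Finset.exists_subset_card_eq hV
    refine ⟨B, hBV, hB, fun A _ A' _ hA hA' => ?_⟩
    rw [Finset.card_eq_zero.1 hA, Finset.card_eq_zero.1 hA']
  | succ n ih =>
    -- End-homogeneous sets: the colour of an `(n + 1)`-subset depends only on its minimum.
    have key : ∀ t : ℕ, ∃ N : ℕ, ∀ (V : Finset ℕ) (χ : Finset ℕ → Fin k), N ≤ V.card →
        ∃ B ⊆ V, B.card = t ∧ ∀ v ∈ B, ∀ A ⊆ B, ∀ A' ⊆ B, A.card = n → A'.card = n →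
          (∀ a ∈ A, v < a) → (∀ a ∈ A', v < a) → χ (insert v A) = χ (insert v A') := by
      intro t
      induction t with
      | zero => exact ⟨0, fun V χ _ => ⟨∅, by simp, by simp, by simp⟩⟩
      | succ t iht =>
        obtain ⟨N, hN⟩ := iht
        obtain ⟨M, hM⟩ := ih N
        refine ⟨M + 1, fun V χ hV => ?_⟩
        have hne : V.Nonempty := Finset.card_pos.1 (by omega)
        have hv := V.min'_mem hne
        set v := V.min' hne with hvdef
        -- Fixing the minimum `v` leaves a colouring of `n`-sets, made constant on `W` by `ih`; the
        -- remaining points are then sought in `W`.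
        obtain ⟨W, hWV, hWc, hW⟩ := hM (V.erase v) (fun A => χ (insert v A))
          (by rw [Finset.card_erase_of_mem hv]; omega)
        obtain ⟨B, hBW, hBc, hB⟩ := hN W χ hWc.ge
        have hlt : ∀ b ∈ B, v < b := fun b hb => by
          have := Finset.mem_erase.1 (hWV (hBW hb))
          exact lt_of_le_of_ne (V.min'_le b this.2) this.1.symm
        have hsub : ∀ w, v ≤ w → ∀ A ⊆ insert v B, (∀ a ∈ A, w < a) → A ⊆ B :=
          fun w hw A hA h a ha => (Finset.mem_insert.1 (hA ha)).resolve_left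
            (hw.trans_lt (h a ha)).ne'
        refine ⟨insert v B, ?_, ?_, ?_⟩
        · exact Finset.insert_subset hv
            ((hBW.trans hWV).trans (Finset.erase_subset _ _))
        · rw [Finset.card_insert_of_notMem fun h => (hlt v h).false, hBc]
        · intro w hw A hA A' hA' hAc hAc' h h'
          rcases Finset.mem_insert.1 hw with rfl | hwB
          · exact hW A ((hsub _ le_rfl A hA h).trans hBW) A'
              ((hsub _ le_rfl A' hA' h').trans hBW) hAc hAc'
          · have hvw := (hlt w hwB).le
            exact hB w hwB A (hsub w hvw A hA h) A' (hsub w hvw A' hA' h') hAc hAc' h h'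
    -- The pigeonhole principle needs only `k * m` points; `n` is slack.
    obtain ⟨N, hN⟩ := key (k * m + n)
    refine ⟨N, fun V χ hV => ?_⟩
    obtain ⟨C, hCV, hCc, hC⟩ := hN V χ hV
    classical
    rcases Nat.eq_zero_or_pos k with rfl | hk
    · exact (χ ∅).elim0
    have : Nonempty (Fin k) := ⟨⟨0, hk⟩⟩
    -- The default goes to points with fewer than `n` elements of `C` above them, which are never
    -- the minimum of an `(n + 1)`-subset of `C`.
    let c : ℕ → Fin k := fun v =>
      if h : ∃ A ⊆ C, A.card = n ∧ ∀ a ∈ A, v < a then χ (insert v h.choose)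
      else Classical.arbitrary _
    have hc : ∀ v ∈ C, ∀ A ⊆ C, A.card = n → (∀ a ∈ A, v < a) → χ (insert v A) = c v := by
      intro v hv A hA hAc h
      have hex : ∃ A ⊆ C, A.card = n ∧ ∀ a ∈ A, v < a := ⟨A, hA, hAc, h⟩
      simp only [c, dif_pos hex]
      exact hC v hv A hA _ hex.choose_spec.1 hAc hex.choose_spec.2.1 h hex.choose_spec.2.2
    obtain ⟨i, -, hi⟩ := Finset.exists_le_card_fiber_of_mul_le_card_of_maps_to
      (s := C) (t := Finset.univ) (f := c) (n := m) (fun _ _ => Finset.mem_univ _)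
      Finset.univ_nonempty (by simp; omega)
    obtain ⟨B, hBC, hB⟩ := Finset.exists_subset_card_eq hi
    have hBC' : B ⊆ C := hBC.trans (Finset.filter_subset _ _)
    have hcol : ∀ A ⊆ B, A.card = n + 1 → χ A = i := by
      intro A hA hAc
      have hne : A.Nonempty := Finset.card_pos.1 (by omega)
      have hv := A.min'_mem hne
      rw [← Finset.insert_erase hv, hc _ (hBC' (hA hv)) _
        ((Finset.erase_subset _ _).trans (hA.trans hBC'))
        (by rw [Finset.card_erase_of_mem hv]; omega)
        (fun a ha => A.min'_lt_of_mem_erase_min' hne ha)]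
      exact (Finset.mem_filter.1 (hBC (hA hv))).2
    exact ⟨B, hBC'.trans hCV, hB, fun A hA A' hA' h h' =>
      (hcol A hA h).trans (hcol A' hA' h').symm⟩

/-- The finite Ramsey theorem for embeddings of finite linear orders. -/
theorem exists_orderEmbedding_forall_coloring (P Q : Type*) [LinearOrder P] [LinearOrder Q]
    [Finite P] [Finite Q] (k : ℕ) :
    ∃ N : ℕ, ∀ χ : (P ↪o Fin N) → Fin k, ∃ b : Q ↪o Fin N,
      ∀ c c' : P ↪o Q, χ (c.trans b) = χ (c'.trans b) := by
  classical
  cases nonempty_fintype P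
  cases nonempty_fintype Q
  -- The extra colour is for sets that are not images of embeddings.
  obtain ⟨N, hN⟩ := Finset.exists_card_eq_forall_card_eq_coloring
    (Fintype.card P) (Fintype.card Q) (k + 1)
  refine ⟨N, fun χ => ?_⟩
  let im : (P ↪o Fin N) → Finset ℕ := fun p => Finset.univ.image fun x => (p x : ℕ)
  have im_inj : Function.Injective im := by
    intro p q hpq
    have hr : Set.range p = Set.range q := by
      ext i
      have := congrArg (fun A : Finset ℕ => (i : ℕ) ∈ A) hpq
      simpa [im, Fin.val_inj] using this
    exact DFunLike.coe_injective ((p.strictMono.range_inj q.strictMono).1 hr)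
  obtain ⟨B, hBN, hBc, hB⟩ := hN (Finset.range N)
    (fun A => if h : ∃ p, im p = A then (χ h.choose).castSucc else Fin.last k) (by simp)
  let e : Q ≃o Fin (Fintype.card Q) := (Fintype.orderIsoFinOfCardEq Q rfl).symm
  have hlt : ∀ q, B.orderEmbOfFin hBc (e q) < N := fun q =>
    Finset.mem_range.1 (hBN (B.orderEmbOfFin_mem hBc _))
  let b : Q ↪o Fin N := OrderEmbedding.ofMapLEIff
    (fun q => ⟨B.orderEmbOfFin hBc (e q), hlt q⟩) (fun q r => by simp [Fin.le_def])
  have hsub : ∀ c : P ↪o Q, im (c.trans b) ⊆ B := by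
    intro c i hi
    obtain ⟨x, -, rfl⟩ := Finset.mem_image.1 hi
    exact B.orderEmbOfFin_mem hBc _
  have hcard : ∀ p, (im p).card = Fintype.card P := fun p =>
    Finset.card_image_of_injective _ (Fin.val_injective.comp p.injective)
  refine ⟨b, fun c c' => ?_⟩
  have hχ : ∀ p, (if h : ∃ q, im q = im p then (χ h.choose).castSucc else Fin.last k)
      = (χ p).castSucc := by
    intro p
    have hex : ∃ q, im q = im p := ⟨p, rfl⟩
    rw [dif_pos hex, im_inj hex.choose_spec]
  have := hB _ (hsub c) _ (hsub c') (hcard _) (hcard _)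
  rw [hχ, hχ] at this
  exact Fin.castSucc_injective _ this

namespace OrdUltrametricSpace

/-! ### Lexicographic ultrametric spaces -/

/-- Functions from a finite set `D` of positive reals to a linear order; the distance of two
functions is the largest element of `D` at which they differ, and they are compared there. -/
def LexFunctions (D : Finset ℝ) (β : Type u) : Type u := Lex ((D : Type)ᵒᵈ → β)

namespace LexFunctions

variable {D : Finset ℝ} {β : Type u}

instance : CoeFun (LexFunctions D β) fun _ => D → β := ⟨fun u s => ofLex u (OrderDual.toDual s)⟩

theorem ext {u v : LexFunctions D β} (h : ∀ s : D, u s = v s) : u = v := funext h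

/-- The function of `LexFunctions D β` with given values. -/
def mk (f : D → β) : LexFunctions D β := toLex fun s => f (OrderDual.ofDual s)

noncomputable instance [LinearOrder β] : LinearOrder (LexFunctions D β) :=
  inferInstanceAs (LinearOrder (Lex ((D : Type)ᵒᵈ → β)))

theorem lt_iff [LinearOrder β] {u v : LexFunctions D β} :
    u < v ↔ ∃ s : D, (∀ t : D, s < t → u t = v t) ∧ u s < v s := Iff.rfl

instance [Finite β] : Finite (LexFunctions D β) :=
  inferInstanceAs (Finite ((D : Type)ᵒᵈ → β))

open Classical in
noncomputable instance : Dist (LexFunctions D β) :=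
  ⟨fun u v => ⨆ s : D, if u s = v s then 0 else (s : ℝ)⟩

theorem dist_le_iff {u v : LexFunctions D β} {r : ℝ} (hr : 0 ≤ r) :
    dist u v ≤ r ↔ ∀ s : D, u s ≠ v s → (s : ℝ) ≤ r := by
  classical
  constructor
  · intro h s hs
    refine le_trans ?_ h
    have := le_ciSup (f := fun s : D => if u s = v s then 0 else (s : ℝ))
      (Set.finite_range _).bddAbove s
    rwa [if_neg hs] at this
  · intro h
    refine Real.iSup_le (fun s => ?_) hr
    split_ifs with hs
    exacts [hr, h s hs]

theorem dist_nonneg' (hD : ∀ s ∈ D, 0 < s) (u v : LexFunctions D β) : 0 ≤ dist u v := by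
  classical
  refine Real.iSup_nonneg fun s => ?_
  split_ifs
  exacts [le_rfl, (hD s s.2).le]

theorem exists_dist_eq {u v : LexFunctions D β} (h : u ≠ v) (hD : ∀ s ∈ D, 0 < s) :
    ∃ s : D, dist u v = s ∧ u s ≠ v s := by
  classical
  obtain ⟨t, ht⟩ : ∃ t : D, u t ≠ v t := by
    by_contra! hc
    exact h (ext hc)
  have : Nonempty D := ⟨t⟩
  obtain ⟨s, hs⟩ := exists_eq_ciSup_of_finite (f := fun s : D => if u s = v s then 0 else (s : ℝ))
  change _ = dist u v at hs
  by_cases hsu : u s = v s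
  · rw [if_pos hsu] at hs
    exact absurd ((dist_le_iff le_rfl).1 hs.ge t ht) (hD t t.2).not_ge
  · exact ⟨s, by rw [← hs, if_neg hsu], hsu⟩

theorem dist_triangle_max' (hD : ∀ s ∈ D, 0 < s) (u v w : LexFunctions D β) :
    dist u w ≤ max (dist u v) (dist v w) := by
  have h1 := dist_nonneg' hD u v
  refine (dist_le_iff (h1.trans (le_max_left _ _))).2 fun s hs => ?_
  by_cases h : u s = v s
  · exact ((dist_le_iff (dist_nonneg' hD v w)).1 le_rfl s (h ▸ hs)).trans (le_max_right _ _)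
  · exact ((dist_le_iff h1).1 le_rfl s h).trans (le_max_left _ _)

/-- `LexFunctions D β` as a metric space, for `D` consisting of positive numbers. -/
noncomputable abbrev toMetricSpace (hD : ∀ s ∈ D, 0 < s) : MetricSpace (LexFunctions D β) where
  dist_self u := le_antisymm ((dist_le_iff le_rfl).2 fun s hs => (hs rfl).elim) (dist_nonneg' hD _ _)
  dist_comm u v := le_antisymm
    ((dist_le_iff (dist_nonneg' hD _ _)).2 fun s hs =>
      (dist_le_iff (dist_nonneg' hD _ _)).1 le_rfl s hs.symm)
    ((dist_le_iff (dist_nonneg' hD _ _)).2 fun s hs =>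
      (dist_le_iff (dist_nonneg' hD _ _)).1 le_rfl s hs.symm)
  dist_triangle u v w := (dist_triangle_max' hD u v w).trans
    (max_le_add_of_nonneg (dist_nonneg' hD _ _) (dist_nonneg' hD _ _))
  eq_of_dist_eq_zero {u v} h := by
    by_contra hne
    obtain ⟨s, hs, -⟩ := exists_dist_eq hne hD
    exact (hD s s.2).ne' (hs.symm.trans h)

end LexFunctions

/-- `LexFunctions D β` as an ordered ultrametric space. -/
noncomputable def ofLexFunctions (D : Finset ℝ) (hD : ∀ s ∈ D, 0 < s) (β : Type u)
    [LinearOrder β] : OrdUltrametricSpace.{u} :=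
  letI := LexFunctions.toMetricSpace (β := β) hD
  { carrier := LexFunctions D β
    isUltrametricDist := ⟨LexFunctions.dist_triangle_max' hD⟩ }

theorem convexlyOrdered_of_dist_le (X : OrdUltrametricSpace.{u})
    (h : ∀ a b c : X.carrier, a ≤ b → b ≤ c → dist a b ≤ dist a c) : X.ConvexlyOrdered := by
  have key : ∀ x a b c : X.carrier, a ≤ b → b ≤ c → dist b x ≤ max (dist a x) (dist c x) := by
    intro x a b c hab hbc
    calc dist b x ≤ max (dist b a) (dist a x) := dist_triangle_max _ _ _
      _ ≤ max (max (dist a x) (dist x c)) (dist a x) :=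
        max_le_max (dist_comm b a ▸ (h a b c hab hbc).trans (dist_triangle_max _ _ _)) le_rfl
      _ = max (dist a x) (dist c x) := by
        rw [dist_comm x c, max_eq_left (le_max_left _ _)]
  exact fun x r => ⟨⟨fun a ha c hc b hb => (key x a b c hb.1 hb.2).trans_lt (max_lt ha hc)⟩,
    ⟨fun a ha c hc b hb => (key x a b c hb.1 hb.2).trans (max_le ha hc)⟩⟩

/-- For `a < b < c` decided at levels `s` and `s'`, the points `a` and `c` differ at `max s s'`;
when `s = s'` the two increases cannot cancel. -/
theorem convexlyOrdered_ofLexFunctions (D : Finset ℝ) (hD : ∀ s ∈ D, 0 < s) (β : Type u)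
    [LinearOrder β] : (ofLexFunctions D hD β).ConvexlyOrdered := by
  refine convexlyOrdered_of_dist_le _ fun a b c hab hbc => ?_
  rcases hab.eq_or_lt with rfl | hab
  · rw [dist_self]; exact dist_nonneg
  rcases hbc.eq_or_lt with rfl | hbc
  · exact le_rfl
  refine (LexFunctions.dist_le_iff (D := D) (β := β) (u := a) (v := b) dist_nonneg).2
    fun t ht => ?_
  obtain ⟨s, hs, hlt⟩ := LexFunctions.lt_iff.1 hab
  obtain ⟨s', hs', hlt'⟩ := LexFunctions.lt_iff.1 hbc
  have hts : t ≤ s := le_of_not_gt fun h => ht (hs t h)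
  have hac := (LexFunctions.dist_le_iff (D := D) (β := β) (u := a) (v := c)
    (r := dist a c) dist_nonneg).1 le_rfl
  rcases lt_trichotomy s s' with h | rfl | h
  · exact (Subtype.coe_le_coe.2 (hts.trans h.le)).trans (hac s' (by rw [hs s' h]; exact hlt'.ne))
  · exact (Subtype.coe_le_coe.2 hts).trans (hac s (hlt.trans hlt').ne)
  · exact (Subtype.coe_le_coe.2 hts).trans (hac s (by rw [← hs' s h]; exact hlt.ne))

theorem ofLexFunctions_mem_finiteConvexlyOrdered {S : Set ℝ} (D : Finset ℝ)
    (hD : ∀ s ∈ D, 0 < s) (hDS : ∀ s ∈ D, s ∈ S) (β : Type u) [LinearOrder β] [Finite β] :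
    ofLexFunctions D hD β ∈ finiteConvexlyOrdered.{u} S := by
  refine ⟨inferInstanceAs (Finite (LexFunctions D β)), convexlyOrdered_ofLexFunctions D hD β,
    fun x y hxy => ?_⟩
  obtain ⟨s, hs, -⟩ := LexFunctions.exists_dist_eq (D := D) (β := β) hxy hD
  change dist x y = s at hs
  rw [hs]
  exact hDS s s.2

/-! ### The linear order of balls -/

/-- The pairs of a level `s` in `D` and a point of `X`, preordered by level, and within a level
by the order of the open balls of radius `s`. -/
def Node (X : OrdUltrametricSpace.{u}) (_ : X.ConvexlyOrdered) (D : Finset ℝ) : Type u :=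
  D × X.carrier

namespace Node

variable {X Y : OrdUltrametricSpace.{u}} {hX : X.ConvexlyOrdered} {hY : Y.ConvexlyOrdered}
  {D : Finset ℝ}

instance [Finite X.carrier] : Finite (Node X hX D) :=
  inferInstanceAs (Finite (D × X.carrier))

/-- Transitivity is where convexity is needed, which is why its proof is a parameter of `Node`. -/
instance : Preorder (Node X hX D) where
  le p q := p.1 < q.1 ∨ p.1 = q.1 ∧ (p.2 ≤ q.2 ∨ dist p.2 q.2 < p.1)
  le_refl p := Or.inr ⟨rfl, Or.inl le_rfl⟩
  le_trans := by
    rintro ⟨s, x⟩ ⟨t, y⟩ ⟨w, z⟩ h h'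
    dsimp only at h h' ⊢
    rcases h with h | ⟨rfl, h⟩
    · rcases h' with h' | ⟨rfl, -⟩
      exacts [Or.inl (h.trans h'), Or.inl h]
    · rcases h' with h' | ⟨rfl, h'⟩
      · exact Or.inl h'
      · refine Or.inr ⟨rfl, ?_⟩
        by_contra! hc
        have hzx := hc.1
        -- In the mixed cases one point lies between two points of an open ball of radius `s`, hence
        -- in that ball.
        rcases h with h | h <;> rcases h' with h' | h'
        · exact (h.trans h').not_gt hzx
        · have hpos : (0 : ℝ) < s := dist_nonneg.trans_lt h'
          have hxz : x ∈ Metric.ball z s := (hX z s).1.out (Metric.mem_ball_self hpos)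
            (Metric.mem_ball.2 h') ⟨hzx.le, h⟩
          exact hc.2.not_gt (Metric.mem_ball.1 hxz)
        · have hpos : (0 : ℝ) < s := dist_nonneg.trans_lt h
          have hxz : z ∈ Metric.ball x s := (hX x s).1.out
            (Metric.mem_ball'.2 h) (Metric.mem_ball_self hpos) ⟨h', hzx.le⟩
          exact hc.2.not_gt (Metric.mem_ball'.1 hxz)
        · exact hc.2.not_gt ((dist_triangle_max x y z).trans_lt (max_lt h h'))

theorem le_iff {p q : Node X hX D} :
    p ≤ q ↔ p.1 < q.1 ∨ p.1 = q.1 ∧ (p.2 ≤ q.2 ∨ dist p.2 q.2 < p.1) := Iff.rfl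

instance : Std.Total (α := Node X hX D) (· ≤ ·) where
  total p q := by
    simp only [le_iff]
    rcases lt_trichotomy p.1 q.1 with h | h | h
    · exact Or.inl (Or.inl h)
    · rcases le_total p.2 q.2 with h' | h'
      · exact Or.inl (Or.inr ⟨h, Or.inl h'⟩)
      · exact Or.inr (Or.inr ⟨h.symm, Or.inl h'⟩)
    · exact Or.inr (Or.inl h)

variable (X hX D) in
/-- The balls of `X` with radii in `D`. -/
abbrev Class : Type u := Antisymmetrization (Node X hX D) (· ≤ ·)

open Classical in
noncomputable instance : LinearOrder (Class X hX D) :=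
  inferInstanceAs (LinearOrder (Antisymmetrization (Node X hX D) (· ≤ ·)))

instance [Finite X.carrier] : Finite (Class X hX D) := Quotient.finite _

/-- The class of a node. -/
def toClass (s : D) (x : X.carrier) : Class X hX D :=
  toAntisymmetrization (α := Node X hX D) (· ≤ ·) (s, x)

theorem toClass_le_toClass {s t : D} {x y : X.carrier} :
    (toClass s x : Class X hX D) ≤ toClass t y ↔
      s < t ∨ s = t ∧ (x ≤ y ∨ dist x y < s) := Iff.rfl

theorem toClass_lt_toClass {s : D} {x y : X.carrier} (h : s ≤ dist x y) (hxy : x < y) :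
    (toClass s x : Class X hX D) < toClass s y := by
  rw [← not_le, toClass_le_toClass]
  simp [hxy, dist_comm y x, h]

theorem toClass_eq_toClass {s : D} {x y : X.carrier} (h : dist x y < s) :
    (toClass s x : Class X hX D) = toClass s y :=
  le_antisymm (toClass_le_toClass.2 (Or.inr ⟨rfl, Or.inr h⟩))
    (toClass_le_toClass.2 (Or.inr ⟨rfl, Or.inr (dist_comm x y ▸ h)⟩))

/-- The map on balls induced by an order preserving isometric embedding. -/
noncomputable def mapClass (f : X.carrier → Y.carrier) (hf : Isometry f) (hm : StrictMono f) :
    Class X hX D ↪o Class Y hY D :=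
  OrderEmbedding.ofMapLEIff
    (Quotient.lift (fun p : Node X hX D => (toClass p.1 (f p.2) : Class Y hY D)) fun p q h => by
      refine le_antisymm (toClass_le_toClass.2 ?_) (toClass_le_toClass.2 ?_)
      · simpa only [hf.dist_eq, hm.le_iff_le] using le_iff.1 h.1
      · simpa only [hf.dist_eq, hm.le_iff_le] using le_iff.1 h.2)
    (by
      rintro ⟨p⟩ ⟨q⟩
      change toClass p.1 (f p.2) ≤ toClass q.1 (f q.2) ↔
        (toClass p.1 p.2 : Class X hX D) ≤ toClass q.1 q.2
      simp only [toClass_le_toClass, hf.dist_eq, hm.le_iff_le])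

end Node

open Node

/-! ### Embeddings from labelled balls -/

section Realize

variable {X : OrdUltrametricSpace.{u}} {hX : X.ConvexlyOrdered} {D : Finset ℝ}
  {hD : ∀ s ∈ D, 0 < s} {β : Type u} [LinearOrder β]

/-- The embedding of `X` given by labelling its balls. -/
noncomputable def realize (hD : ∀ s ∈ D, 0 < s) (L : Class X hX D ↪o β) (x : X.carrier) :
    (ofLexFunctions D hD β).carrier :=
  LexFunctions.mk fun s => L (toClass s x)

/-- Open balls about `x` and `y` coincide at radii above `dist x y` and differ at radius `dist x y`,
so that level decides the comparison. -/
theorem strictMono_realize (hXD : X.DistancesIn D) (L : Class X hX D ↪o β) :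
    StrictMono (realize hD L) := by
  intro x y hxy
  refine LexFunctions.lt_iff.2 ⟨⟨dist x y, hXD x y hxy.ne⟩, fun t ht => ?_, ?_⟩
  · exact congrArg L (toClass_eq_toClass ht)
  · exact L.strictMono (toClass_lt_toClass le_rfl hxy)

theorem isometry_realize (hXD : X.DistancesIn D) (L : Class X hX D ↪o β) :
    Isometry (realize hD L) := by
  refine Isometry.of_dist_eq fun x y => ?_
  wlog hxy : x < y generalizing x y
  · rcases (not_lt.1 hxy).eq_or_lt with rfl | h
    · simp
    · rw [dist_comm, this y x h, dist_comm]
  refine le_antisymm ((LexFunctions.dist_le_iff (D := D) (β := β) dist_nonneg).2 fun s hs => ?_) ?_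
  · exact le_of_not_gt fun h => hs (congrArg L (toClass_eq_toClass h))
  · exact (LexFunctions.dist_le_iff (D := D) (β := β) (u := realize hD L x)
      (v := realize hD L y) (dist_nonneg (x := realize hD L x) (y := realize hD L y))).1 le_rfl
      ⟨dist x y, hXD x y hxy.ne⟩ (L.strictMono (toClass_lt_toClass le_rfl hxy)).ne

end Realize

/-! ### Copies as ranges of embeddings -/

/-- The range of an order preserving isometric embedding of `X` is a copy of `X`. -/
theorem range_mem_copies {X Z : OrdUltrametricSpace.{u}} {f : X.carrier → Z.carrier}
    (hf : Isometry f) (hm : StrictMono f) : Set.range f ∈ Z.copies X := by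
  refine ⟨(hm.orderIso f), ?_⟩
  exact Isometry.of_dist_eq fun x y => hf.dist_eq x y

theorem exists_eq_range_comp_of_subset_range {X Y Z : OrdUltrametricSpace.{u}}
    {g : Y.carrier → Z.carrier} (hg : Isometry g) (hm : StrictMono g) {A : Set Z.carrier}
    (hA : A ∈ Z.copies X) (hAg : A ⊆ Set.range g) :
    ∃ f : X.carrier → Y.carrier, Isometry f ∧ StrictMono f ∧ A = Set.range (g ∘ f) := by
  obtain ⟨e, he⟩ := hA
  choose f hf using fun x => hAg (e x).2
  refine ⟨f, Isometry.of_dist_eq fun x y => ?_, fun x y hxy => ?_, ?_⟩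
  · rw [← hg.dist_eq, hf, hf, ← Subtype.dist_eq, he.dist_eq]
  · rw [← hm.lt_iff_lt, hf, hf]
    exact e.strictMono hxy
  · ext z
    constructor
    · intro hz
      exact ⟨e.symm ⟨z, hz⟩, by simp [hf]⟩
    · rintro ⟨x, rfl⟩
      simp [hf]

theorem exists_finset_distancesIn {S : Set ℝ} (X : OrdUltrametricSpace.{u}) [Finite X.carrier]
    (h : X.DistancesIn S) : ∃ D : Finset ℝ, ↑D ⊆ S ∧ X.DistancesIn D := by
  have hfin : {r | ∃ x y : X.carrier, x ≠ y ∧ dist x y = r}.Finite :=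
    (Set.finite_range fun p : X.carrier × X.carrier => dist p.1 p.2).subset
      fun r ⟨x, y, _, hr⟩ => ⟨(x, y), hr⟩
  refine ⟨hfin.toFinset, ?_, fun x y hxy => ?_⟩
  · intro r hr
    obtain ⟨x, y, hxy, rfl⟩ := hfin.mem_toFinset.1 hr
    exact h x y hxy
  · exact hfin.mem_toFinset.2 ⟨x, y, hxy, rfl⟩

end OrdUltrametricSpace

open OrdUltrametricSpace Node in
theorem mainTheorem2 (S : Set ℝ) (hS : S ⊆ Set.Ioi 0) :
    OrdUltrametricSpace.RamseyProperty.{u}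
      (OrdUltrametricSpace.finiteConvexlyOrdered.{u} S) := by
  classical
  rintro X ⟨hXf, hXc, hXS⟩ Y ⟨hYf, hYc, hYS⟩ k -
  obtain ⟨D₁, hD₁S, hXD₁⟩ := exists_finset_distancesIn X hXS
  obtain ⟨D₂, hD₂S, hYD₂⟩ := exists_finset_distancesIn Y hYS
  -- `mapClass` needs the same levels for `X` and `Y`.
  set D := D₁ ∪ D₂ with hDdef
  have hDS : ∀ s ∈ D, s ∈ S := fun s hs =>
    (Finset.mem_union.1 hs).elim (fun h => hD₁S h) (fun h => hD₂S h)
  have hD : ∀ s ∈ D, 0 < s := fun s hs => hS (hDS s hs)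
  have hXD : X.DistancesIn D := fun x y h => Finset.mem_union_left _ (hXD₁ x y h)
  have hYD : Y.DistancesIn D := fun x y h => Finset.mem_union_right _ (hYD₂ x y h)
  obtain ⟨N, hN⟩ := exists_orderEmbedding_forall_coloring (Class X hXc D) (Class Y hYc D) k
  let e : Fin N ↪o ULift.{u} (Fin N) := 
    OrderEmbedding.ofMapLEIff ULift.up fun _ _ => ULift.up_le
  refine ⟨ofLexFunctions D hD (ULift.{u} (Fin N)),
    ofLexFunctions_mem_finiteConvexlyOrdered D hD hDS _, fun χ => ?_⟩
  obtain ⟨b, hb⟩ := hN fun L => χ ⟨Set.range (realize hD (L.trans e)),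
    range_mem_copies (isometry_realize hXD _) (strictMono_realize hXD _)⟩
  have hg := isometry_realize (hD := hD) hYD (b.trans e)
  have hgm := strictMono_realize (hD := hD) hYD (b.trans e)
  refine ⟨_, range_mem_copies hg hgm, ?_⟩
  rintro ⟨A, hA⟩ ⟨A', hA'⟩ hAB hAB'
  obtain ⟨f, hf, hfm, rfl⟩ := exists_eq_range_comp_of_subset_range hg hgm hA hAB
  obtain ⟨f', hf', hfm', rfl⟩ := exists_eq_range_comp_of_subset_range hg hgm hA' hAB'
  -- By definition, realizing `Y` after `f` is realizing `X` with its labels pulled back along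
  -- `mapClass f`.
  exact hb (mapClass f hf hfm) (mapClass f' hf' hfm')
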